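/- Graphs are finite, simple and undirected, with vertex set $V=[n]$ ($n$ depends on the graph) and a node feature $X_v\in\mathbb R^d$ for each $v\in V$. "Continuous aggregation" means a permutation-invariant function from finite multisets to some $\mathbb R^k$ that is continuous on multisets of each fixed size. MLPs are ReLU multilayer perceptrons. All feature dimensions and the numbers of layers of a model are arbitrary. A model $M$ separates $G_1,G_2$ if $M(G_1)\neq M(G_2)$. **CS-GNN with $\mathcal T$.** For a graph $G=(V,E)$ let $\mathcal T(G)=\{\{v\}: v\in V\}\cup E\subseteq\mathcal P(V)$, and for $S,S'\in\mathcal T(G)$ write $S\sim_{\mathcal T}S'$ if some $i\in S$ and some $j\in S'$ are adjacent in $G$. A CS-GNN model with $\mathcal T$ starts from the simple node marking $\mathcal X^0(S,v)=[X_v,\mathbf 1_{v\in S}]$ for $(S,v)\in\mathcal T(G)\times V$, applies finitely many layers $$\mathcal X^{t+1}(S,v)=f^t\Big(\mathcal X^t(S,v),\ \mathrm{agg}^t_1\{\!\{\mathcal X^t(S,v'): v'\sim v\}\!\},\ \mathrm{agg}^t_2\{\!\{\mathcal X^t(S',v): S'\sim_{\mathcal T}S\}\!\},$$ $$\mathrm{agg}^t_3\{\!\{(\mathcal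 X^t(S',v),z(S,v,S',v)): S'\in\mathcal T(G),\,v\in S'\}\!\},\ \mathrm{agg}^t_4\{\!\{(\mathcal X^t(S,v'),z(S,v,S,v')): v'\in S\}\!\}\Big)$$ with $f^t$ continuous and $\mathrm{agg}^t_i$ continuous aggregations, and outputs $\mathrm{MLP}_2\big(\sum_{S\in\mathcal T(G)}\mathrm{MLP}_1(\sum_{v\in V}\mathcal X^{\mathtt T}(S,v))\big)$, where $\mathcal X^{\mathtt T}$ is the final feature map. Here $z(S_1,i_1,S_2,i_2)\in\mathbb R^8$ encodes the orbit of $(S_1,i_1,S_2,i_2)$ under permutations of $[n]$: it lists $\mathbf 1_{i_1=i_2}$, $|S_1|$, $|S_2|$, $|S_1\cap S_2|$ and the four indicators of $i_a\in S_b$. **Node-based subgraph GNNs.** The bag contains one marked copy of $G$ for each $u\in V$. A model starts from $\mathcal X^0(u,v)=[X_v,m(d_G(u,v))]$, where $d_G$ is the shortest-path distance, with values in $\mathbb N\cup\{\infty\}$, and $m$ is any function with values in some $\mathbb R^k$ (node marking is $m=\mathbf 1_{\{0\}}$). It applies finitely many layers $$\mathcal X^{t+1}(u,v)=f^t\Big(\mathcal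 X^t(u,v),\mathcal X^t(u,u),\mathcal X^t(v,v),\mathcal X^t(v,u),\ \mathrm{agg}^t_1\{\!\{\mathcal X^t(u,v'): v'\sim v\}\!\},\ \mathrm{agg}^t_2\{\!\{\mathcal X^t(u',v): u'\sim u\}\!\},$$ $$\mathrm{agg}^t_3\{\!\{\mathcal X^t(u,w): w\in V\}\!\},\ \mathrm{agg}^t_4\{\!\{\mathcal X^t(w,v): w\in V\}\!\}\Big)$$ with $f^t$ continuous and $\mathrm{agg}^t_i$ continuous aggregations (each may ignore any of its arguments), and outputs $\mathrm{MLP}_2(\sum_{u}\mathrm{MLP}_1(\sum_{v}\mathcal X^{\mathtt T}(u,v)))$ or $\mathrm{MLP}_2(\sum_{v}\mathrm{MLP}_1(\sum_{u}\mathcal X^{\mathtt T}(u,v)))$. In particular this class contains GNN-SSWL+, which uses node marking, the arguments $\mathcal X^t(u,v),\mathcal X^t(u,u),\mathcal X^t(v,v)$, $\mathrm{agg}_1$, $\mathrm{agg}_2$, and the first pooling. **Proposition.** For every feature dimension $d$: 1. If $G_1,G_2$ are graphs that some node-based subgraph GNN with output in $\mathbb R^o$ separates, then some CS-GNN model with $\mathcal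 T$ and output in $\mathbb R^o$ separates them. 2. There are graphs $G_1,G_2$ such that $M(G_1)=M(G_2)$ for every node-based subgraph GNN $M$, while some CS-GNN model with $\mathcal T$ separates $G_1$ and $G_2$. -/

import Mathlib

noncomputable section

open scoped Classical

/-- Feature vectors. -/
abbrev Vec (d : ℕ) : Type := Fin d → ℝ

/-- A finite undirected graph on the vertex set `[n]`, with a feature vector in `ℝ^d` at each
node. -/
structure FeatGraph (d : ℕ) where
  n : ℕ
  graph : SimpleGraph (Fin n)
  feat : Fin n → Vec d

/-- Multilayer perceptrons with ReLU activation: an affine map, or an affine map followed by the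
entrywise ReLU and a further perceptron. -/
inductive MLP : ℕ → ℕ → Type
  | affine {m k : ℕ} (W : Matrix (Fin k) (Fin m) ℝ) (b : Vec k) : MLP m k
  | hidden {m l k : ℕ} (W : Matrix (Fin l) (Fin m) ℝ) (b : Vec l) (next : MLP l k) : MLP m k

/-- The function computed by a multilayer perceptron. -/
def MLP.eval : {m k : ℕ} → MLP m k → Vec m → Vec k
  | _, _, .affine W b, x => W.mulVec x + b
  | _, _, .hidden W b next, x => next.eval fun i => max ((W.mulVec x + b) i) 0

/-- A continuous permutation-invariant aggregation: a function of finite multisets whose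
restriction to the multisets of each fixed size is continuous in the entries. -/
structure Agg (α : Type) [TopologicalSpace α] (k : ℕ) where
  toFun : Multiset α → Vec k
  continuous_toFun : ∀ m : ℕ,
    Continuous fun x : Fin m → α => toFun ((Finset.univ : Finset (Fin m)).val.map x)

/-! ### Coarsening-based subgraph GNNs -/

/-- A coarsening function sends a graph on `[n]` to a set of super-nodes, i.e. of subsets of
`[n]`. -/
abbrev Coarsening : Type := (n : ℕ) → SimpleGraph (Fin n) → Finset (Finset (Fin n))

/-- The coarsening function whose super-nodes are all singletons and all edges. -/
def singletonsAndEdges : Coarsening := fun n G =>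
  Finset.univ.filter fun S : Finset (Fin n) =>
    (∃ v, S = {v}) ∨ ∃ u v, G.Adj u v ∧ S = {u, v}

/-- Adjacency of super-nodes in the coarsened graph. (A super-node containing an edge is adjacent
to itself.) -/
def CoarseAdj {n : ℕ} (G : SimpleGraph (Fin n)) (S S' : Finset (Fin n)) : Prop :=
  ∃ i ∈ S, ∃ j ∈ S', G.Adj i j

/-- Indicator of a proposition. -/
def ind (p : Prop) : ℝ := if p then 1 else 0

/-- The vector encoding the orbit of `(S₁, i₁, S₂, i₂)` under permutations of `[n]`: whether
`i₁ = i₂`, the sizes of `S₁`, `S₂` and `S₁ ∩ S₂`, and which `i`'s belong to which `S`'s. -/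
def orbitCode {n : ℕ} (S₁ : Finset (Fin n)) (i₁ : Fin n) (S₂ : Finset (Fin n)) (i₂ : Fin n) :
    Vec 8 :=
  ![ind (i₁ = i₂), (S₁.card : ℝ), (S₂.card : ℝ), ((S₁ ∩ S₂).card : ℝ),
    ind (i₁ ∈ S₁), ind (i₂ ∈ S₂), ind (i₁ ∈ S₂), ind (i₂ ∈ S₁)]

/-- The parameters of one CS-GNN layer, from features in `ℝ^p` to features in `ℝ^q`. -/
structure CSLayer (p q : ℕ) where
  (k₁ k₂ k₃ k₄ : ℕ)
  agg₁ : Agg (Vec p) k₁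
  agg₂ : Agg (Vec p) k₂
  agg₃ : Agg (Vec p × Vec 8) k₃
  agg₄ : Agg (Vec p × Vec 8) k₄
  f : Vec p × Vec k₁ × Vec k₂ × Vec k₃ × Vec k₄ → Vec q
  continuous_f : Continuous f

/-- The CS-GNN update of a feature map on pairs (super-node, node). Only the values at
super-nodes of the coarsened graph are meaningful; no other value is ever read at such a pair. -/
def CSLayer.update {p q : ℕ} (L : CSLayer p q) (T : Coarsening) {n : ℕ}
    (G : SimpleGraph (Fin n)) (X : Finset (Fin n) → Fin n → Vec p) :
    Finset (Fin n) → Fin n → Vec q := fun S v =>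
  L.f (X S v,
    L.agg₁.toFun ((Finset.univ.filter fun v' => G.Adj v v').val.map fun v' => X S v'),
    L.agg₂.toFun (((T n G).filter fun S' => CoarseAdj G S S').val.map fun S' => X S' v),
    L.agg₃.toFun (((T n G).filter fun S' => v ∈ S').val.map fun S' =>
      (X S' v, orbitCode S v S' v)),
    L.agg₄.toFun (S.val.map fun v' => (X S v', orbitCode S v S v')))

/-- A finite stack of CS-GNN layers. -/
inductive CSStack : ℕ → ℕ → Type
  | nil {p : ℕ} : CSStack p p
  | cons {p q r : ℕ} (L : CSLayer p q) (rest : CSStack q r) : CSStack p r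

/-- Apply the layers one after the other. -/
def CSStack.run (T : Coarsening) {n : ℕ} (G : SimpleGraph (Fin n)) : {p r : ℕ} → CSStack p r →
    (Finset (Fin n) → Fin n → Vec p) → Finset (Fin n) → Fin n → Vec r
  | _, _, .nil, X => X
  | _, _, .cons L rest, X => rest.run T G (L.update T G X)

/-- Simple node marking: `(S, v)` gets the features of `v` and the bit telling whether `v ∈ S`. -/
def simpleMarking {d : ℕ} (G : FeatGraph d) (S : Finset (Fin G.n)) (v : Fin G.n) : Vec (d + 1) :=
  Fin.snoc (α := fun _ => ℝ) (G.feat v) (ind (v ∈ S))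

/-- A CS-GNN model with simple node marking, on graphs with features in `ℝ^d` and with output in
`ℝ^o`. -/
structure CSGNN (d o : ℕ) where
  (r s : ℕ)
  layers : CSStack (d + 1) r
  mlp₁ : MLP r s
  mlp₂ : MLP s o

/-- The output of a CS-GNN model that uses the coarsening function `T`. -/
def CSGNN.eval {d o : ℕ} (M : CSGNN d o) (T : Coarsening) (G : FeatGraph d) : Vec o :=
  M.mlp₂.eval (∑ S ∈ T G.n G.graph,
    M.mlp₁.eval (∑ v, M.layers.run T G.graph (simpleMarking G) S v))

/-! ### Node-based subgraph GNNs -/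

/-- The parameters of one layer of a node-based subgraph GNN. -/
structure NodeLayer (p q : ℕ) where
  (k₁ k₂ k₃ k₄ : ℕ)
  agg₁ : Agg (Vec p) k₁
  agg₂ : Agg (Vec p) k₂
  agg₃ : Agg (Vec p) k₃
  agg₄ : Agg (Vec p) k₄
  f : Vec p × Vec p × Vec p × Vec p × Vec k₁ × Vec k₂ × Vec k₃ × Vec k₄ → Vec q
  continuous_f : Continuous f

/-- The update of `X u v`, the feature of the node `v` in the subgraph with root `u`. It may use
the values at `(u, v)`, `(u, u)`, `(v, v)`, `(v, u)`, aggregate over the neighbours of `v` inside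
the subgraph and over the copies of `v` in the subgraphs of the neighbours of `u`, and aggregate
over the whole subgraph and over all copies of `v`. As `f` may ignore any argument, every
architecture that uses only some of these operations is covered. -/
def NodeLayer.update {p q : ℕ} (L : NodeLayer p q) {n : ℕ} (G : SimpleGraph (Fin n))
    (X : Fin n → Fin n → Vec p) : Fin n → Fin n → Vec q := fun u v =>
  L.f (X u v, X u u, X v v, X v u,
    L.agg₁.toFun ((Finset.univ.filter fun v' => G.Adj v v').val.map fun v' => X u v'),
    L.agg₂.toFun ((Finset.univ.filter fun u' => G.Adj u u').val.map fun u' => X u' v),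
    L.agg₃.toFun (Finset.univ.val.map fun w => X u w),
    L.agg₄.toFun (Finset.univ.val.map fun w => X w v))

/-- A finite stack of layers. -/
inductive NodeStack : ℕ → ℕ → Type
  | nil {p : ℕ} : NodeStack p p
  | cons {p q r : ℕ} (L : NodeLayer p q) (rest : NodeStack q r) : NodeStack p r

/-- Apply the layers one after the other. -/
def NodeStack.run {n : ℕ} (G : SimpleGraph (Fin n)) : {p r : ℕ} → NodeStack p r →
    (Fin n → Fin n → Vec p) → Fin n → Fin n → Vec r
  | _, _, .nil, X => X
  | _, _, .cons L rest, X => rest.run G (L.update G X)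

/-- The two pooling orders: first over the nodes of each subgraph and then over the subgraphs, or
first over the copies of each node and then over the nodes. -/
inductive PoolOrder
  | nodesFirst
  | subgraphsFirst

/-- A node-based subgraph GNN. The bag holds one marked copy of the graph for each node `u`, and
in the copy of `u` a node `v` is marked by a function of the distance from `u` to `v`. Binary node
marking is the function that is `1` at distance `0` and `0` elsewhere; distance encoding and
membership of `v` in the ego-net of `u` are others. -/
structure NodeGNN (d o : ℕ) where
  (k r s : ℕ)
  mark : ℕ∞ → Vec k
  layers : NodeStack (d + k) r
  pool : PoolOrder
  mlp₁ : MLP r s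
  mlp₂ : MLP s o

/-- The initial features: those of `v`, together with the mark of `v` in the copy of `u`. -/
def NodeGNN.init {d o : ℕ} (M : NodeGNN d o) (G : FeatGraph d) (u v : Fin G.n) : Vec (d + M.k) :=
  Fin.append (G.feat v) (M.mark (G.graph.edist u v))

/-- The final node features. -/
def NodeGNN.final {d o : ℕ} (M : NodeGNN d o) (G : FeatGraph d) : Fin G.n → Fin G.n → Vec M.r :=
  M.layers.run G.graph (M.init G)

/-- The output of a node-based subgraph GNN. -/
def NodeGNN.eval {d o : ℕ} (M : NodeGNN d o) (G : FeatGraph d) : Vec o :=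
  match M.pool with
  | .nodesFirst => M.mlp₂.eval (∑ u, M.mlp₁.eval (∑ v, M.final G u v))
  | .subgraphsFirst => M.mlp₂.eval (∑ v, M.mlp₁.eval (∑ u, M.final G u v))

end

/-! Part 1. Fix two graphs that no CS-GNN separates. Among the finitely many partitions of the
triples (graph, `S`, `v`) that CS-GNN stacks induce, those refining the marking partition have a
minimal one (`CSStack.exists_stable`). No layer refines its features `X`, so they determine
everything a layer reads. Set `c u v = X {u} v`. Singleton super-nodes can be told apart by their
size, so `c` is equitable for every local operation of a node-based network
(`StableFeatures.locallyEquitable`), and it determines distances. Pooling makes the two graphs agree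
on the multiset of the colours `c v v`.

The obstacle is aggregation over all `w`, for which a CS-GNN has no counterpart. Inside the
component of `u` it is harmless: a sum over the component is computed sphere by sphere, moving along
edges. Between components `c` may carry uncontrolled information, so `splitColour` forgets all but
`c u u` and `c v v` there. This stays locally equitable, and the sums over all `w` are now
determined by the diagonal multiset and a correction inside one component. Every node-based network
is then constant on colours (`RespectsColour.run`), so its outputs agree.

Part 2. The 4×4 rook's graph and the Shrikhande graph are strongly regular with the same parameters,
so equal/adjacent/neither is an equitable colouring and no node-based network separates them. Edge
super-nodes let a CS-GNN detect `K₄`, which only the rook's graph contains. -/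

noncomputable section

open scoped Classical

section

/-! ### Multisets of colours -/

/-- Equal multisets of colours give a matching that preserves colours, so anything determined by the
colour has equal multisets too. Nearly every equality of aggregated multisets below comes from this.
-/
theorem Multiset.map_eq_map_of_map_eq {α β γ δ : Type*} {s : Multiset α} {t : Multiset β}
    {f : α → γ} {f' : β → γ} {g : α → δ} {g' : β → δ} (h : s.map f = t.map f')
    (hg : ∀ a ∈ s, ∀ b ∈ t, f a = f' b → g a = g' b) : s.map g = t.map g' := by
  rw [← Multiset.rel_eq, Multiset.rel_map] at h ⊢
  exact h.mono fun a ha b hb hab => hg a ha b hb hab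

theorem Multiset.map_filter_eq_filterMap_id {α γ : Type*} (s : Multiset α) (f : α → γ)
    (p : α → Prop) [DecidablePred p] :
    (s.filter p).map f = (s.map fun a => if p a then some (f a) else none).filterMap id := by
  induction s using Multiset.induction_on with
  | empty => simp
  | cons a s ih => by_cases ha : p a <;> simp [ha, ih]

theorem Multiset.map_filter_eq_of_map_eq {α β γ : Type*} {s : Multiset α} {t : Multiset β}
    {f : α → γ} {f' : β → γ} {p : α → Prop} {q : β → Prop} [DecidablePred p] [DecidablePred q]
    (h : s.map f = t.map f')
    (hp : ∀ a ∈ s, ∀ b ∈ t, f a = f' b → (p a ↔ q b)) :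
    (s.filter p).map f = (t.filter q).map f' := by
  rw [map_filter_eq_filterMap_id, map_filter_eq_filterMap_id]
  exact congrArg _ (map_eq_map_of_map_eq h fun a ha b hb hab => by
    simp only [hp a ha b hb hab, hab])

theorem Multiset.map_eq_map_of_forall_sum_ite_eq {α β γ : Type*} [DecidableEq γ] {s : Finset α} {t : Finset β}
    {f : α → γ} {f' : β → γ}
    (h : ∀ z, ∑ a ∈ s, (if f a = z then (1 : ℝ) else 0) = ∑ b ∈ t, if f' b = z then (1 : ℝ) else 0) :
    s.val.map f = t.val.map f' := by
  ext z
  have := h z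
  simp only [Finset.sum_boole] at this
  rw [Multiset.count_map, Multiset.count_map]
  simp only [eq_comm (a := z)]
  exact_mod_cast this

/-! ### Distances -/

namespace SimpleGraph

/-- The neighbours of a vertex, as a finite set. -/
abbrev nbrs {n : ℕ} (G : SimpleGraph (Fin n)) (v : Fin n) : Finset (Fin n) :=
  Finset.univ.filter fun x => G.Adj v x

theorem edist_le_coe_iff {V : Type*} (G : SimpleGraph V) {u v : V} {k : ℕ} :
    G.edist u v ≤ k ↔ ∃ w : G.Walk u v, w.length ≤ k := by
  constructor
  · intro h
    have hne : G.edist u v ≠ ⊤ := fun h' => by simp [h'] at h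
    obtain ⟨w, hw⟩ := G.exists_walk_of_edist_ne_top hne
    exact ⟨w, by rw [← hw] at h; exact_mod_cast h⟩
  · rintro ⟨w, hw⟩
    exact (edist_le w).trans (by exact_mod_cast hw)

theorem edist_le_succ_iff {V : Type*} (G : SimpleGraph V) {u v : V} {k : ℕ} :
    G.edist u v ≤ (k + 1 : ℕ) ↔ u = v ∨ ∃ x, G.Adj v x ∧ G.edist u x ≤ k := by
  rw [edist_comm, edist_le_coe_iff]
  constructor
  · rintro ⟨w, hw⟩
    cases w with
    | nil => exact Or.inl rfl
    | @cons _ x _ h p =>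
      refine Or.inr ⟨x, h, ?_⟩
      rw [edist_comm, edist_le_coe_iff]
      exact ⟨p, by simpa using hw⟩
  · rintro (rfl | ⟨x, hx, h⟩)
    · exact ⟨.nil, by simp⟩
    · rw [edist_comm, edist_le_coe_iff] at h
      obtain ⟨p, hp⟩ := h
      exact ⟨.cons hx p, by simpa using hp⟩

theorem edist_le_add_one_of_adj {V : Type*} (G : SimpleGraph V) {u x y : V} (h : G.Adj x y) :
    G.edist u x ≤ G.edist u y + 1 := by
  refine G.edist_triangle (v := y) |>.trans ?_
  rw [edist_eq_one_iff_adj.2 h.symm]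

theorem edist_eq_top_of_adj {V : Type*} (G : SimpleGraph V) {u x y : V} (h : G.Adj x y)
    (hx : G.edist u x = ⊤) : G.edist u y = ⊤ := by
  have := G.edist_le_add_one_of_adj (u := u) h
  rw [hx, top_le_iff] at this
  simpa using this

theorem exists_adj_edist_eq {V : Type*} (G : SimpleGraph V) {u x : V} {k : ℕ}
    (h : G.edist u x = (k + 1 : ℕ)) : ∃ y, G.Adj x y ∧ G.edist u y = k := by
  rcases G.edist_le_succ_iff.1 h.le with rfl | ⟨y, hy, hk⟩
  · rw [edist_self] at h
    exact absurd h.symm (by exact_mod_cast k.succ_ne_zero)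
  · refine ⟨y, hy, hk.antisymm ?_⟩
    have := G.edist_le_add_one_of_adj (u := u) hy
    rw [h] at this
    push_cast at this
    exact (ENat.add_le_add_iff_right ENat.one_ne_top).1 this

end SimpleGraph

/-! ### Equitable colourings of pairs of nodes -/

variable {ι : Type} {d : ℕ} {K : Type}

/-- A colouring of the pairs of nodes of several graphs, such that the colour of `(u, v)` determines
the features of `v`, whether `u = v`, the colours of `(u, u)` and `(v, v)`, and the multisets of the
colours of the pairs obtained by moving one of the nodes along an edge. -/
structure LocallyEquitable (G : ι → FeatGraph d) (c : ∀ i, Fin (G i).n → Fin (G i).n → K) :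
    Prop where
  feat : ∀ {i j u v u' v'}, c i u v = c j u' v' → (G i).feat v = (G j).feat v'
  eq_iff : ∀ {i j u v u' v'}, c i u v = c j u' v' → (u = v ↔ u' = v')
  left : ∀ {i j u v u' v'}, c i u v = c j u' v' → c i u u = c j u' u'
  right : ∀ {i j u v u' v'}, c i u v = c j u' v' → c i v v = c j v' v'
  nbrs_right : ∀ {i j u v u' v'}, c i u v = c j u' v' →
    ((G i).graph.nbrs v).val.map (fun x => c i u x) =
      ((G j).graph.nbrs v').val.map fun x => c j u' x
  nbrs_left : ∀ {i j u v u' v'}, c i u v = c j u' v' →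
    ((G i).graph.nbrs u).val.map (fun x => c i x v) =
      ((G j).graph.nbrs u').val.map fun x => c j x v'

/-- The colour of `(u, u)` determines the multiset of the colours of all `(u, w)`. -/
def GloballyEquitable (G : ι → FeatGraph d) (c : ∀ i, Fin (G i).n → Fin (G i).n → K) : Prop :=
  ∀ {i j u u'}, c i u u = c j u' u' →
    (Finset.univ.val.map fun w => c i u w) = Finset.univ.val.map fun w => c j u' w

/-- All the graphs have the same multiset of colours of the pairs `(v, v)`. -/
def SameDiagonals (G : ι → FeatGraph d) (c : ∀ i, Fin (G i).n → Fin (G i).n → K) : Prop :=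
  ∀ i j, (Finset.univ.val.map fun v => c i v v) = Finset.univ.val.map fun v => c j v v

/-- A function of pairs of nodes that depends only on their colour. -/
def ColourInvariant {G : ι → FeatGraph d} (c : ∀ i, Fin (G i).n → Fin (G i).n → K)
    {α : Type} (h : ∀ i, Fin (G i).n → Fin (G i).n → α) : Prop :=
  ∀ {i j u v u' v'}, c i u v = c j u' v' → h i u v = h j u' v'

namespace LocallyEquitable

variable {G : ι → FeatGraph d} {c : ∀ i, Fin (G i).n → Fin (G i).n → K}

/-- Breadth-first search from `u`: the colour knows distance zero, and the colours on the neighbours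
of `v` tell whether one of them lies within `k`. -/
theorem edist_le_iff (hc : LocallyEquitable G c) (k : ℕ) : ∀ {i j u v u' v'},
    c i u v = c j u' v' → ((G i).graph.edist u v ≤ k ↔ (G j).graph.edist u' v' ≤ k) := by
  induction k with
  | zero => intro i j u v u' v' h; simpa using hc.eq_iff h
  | succ k ih =>
    have half : ∀ {i j u v u' v'}, c i u v = c j u' v' →
        (G i).graph.edist u v ≤ (k + 1 : ℕ) → (G j).graph.edist u' v' ≤ (k + 1 : ℕ) := by
      intro i j u v u' v' h hle
      rw [SimpleGraph.edist_le_succ_iff] at hle ⊢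
      refine hle.imp (hc.eq_iff h).1 ?_
      rintro ⟨x, hx, hk⟩
      have hm : c i u x ∈ ((G j).graph.nbrs v').val.map fun x => c j u' x := by
        rw [← hc.nbrs_right h]
        exact Multiset.mem_map_of_mem _ (by simpa using hx)
      obtain ⟨y, hy, hxy⟩ := Multiset.mem_map.1 hm
      exact ⟨y, by simpa using hy, (ih hxy.symm).1 hk⟩
    intro i j u v u' v' h
    exact ⟨half h, half h.symm⟩

theorem edist_eq (hc : LocallyEquitable G c) :
    ColourInvariant c fun i u v => (G i).graph.edist u v := by
  intro i j u v u' v' h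
  refine ENat.eq_of_forall_natCast_le_iff fun k => ?_
  cases k with
  | zero => simp
  | succ k =>
    have := (hc.edist_le_iff k h).not
    simp only [not_le] at this
    simpa [← ENat.add_one_le_iff (ENat.natCast_ne_top k)] using this

/-! ### Sums over spheres and components -/

theorem sum_nbrs_eq (hc : LocallyEquitable G c) {h : ∀ i, Fin (G i).n → Fin (G i).n → ℝ}
    (hh : ColourInvariant c h) :
    ColourInvariant c fun i u v => ∑ x ∈ (G i).graph.nbrs v, h i u x := by
  intro i j u v u' v' huv
  exact congrArg Multiset.sum
    (Multiset.map_eq_map_of_map_eq (hc.nbrs_right huv) fun _ _ _ _ e => hh e)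

/-- Each node `x` at distance `k + 1` splits its weight evenly among its `b` neighbours at distance
`k`. This turns the sum over a sphere into a sum over the previous one, with a new weight that is
again colour invariant; hence the induction is over all `h` at once. -/
theorem sum_edist_eq (hc : LocallyEquitable G c) (k : ℕ) :
    ∀ {h : ∀ i, Fin (G i).n → Fin (G i).n → ℝ}, ColourInvariant c h → ∀ {i j u u'},
      c i u u = c j u' u' →
      ∑ x, (if (G i).graph.edist u x = k then h i u x else 0) =
        ∑ x, if (G j).graph.edist u' x = k then h j u' x else 0 := by
  induction k with
  | zero =>
    intro h hh i j u u' huu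
    simpa using hh huu
  | succ k ih =>
    intro h hh i j u u' huu
    let e : ∀ i, Fin (G i).n → Fin (G i).n → ℝ := fun i u y =>
      if (G i).graph.edist u y = k then 1 else 0
    have he : ColourInvariant c e := fun {i j u v u' v'} huv => by
      simp only [e, hc.edist_eq huv]
    let b : ∀ i, Fin (G i).n → Fin (G i).n → ℝ := fun i u x => ∑ y ∈ (G i).graph.nbrs x, e i u y
    have hb : ColourInvariant c b := hc.sum_nbrs_eq he
    let g : ∀ i, Fin (G i).n → Fin (G i).n → ℝ := fun i u x =>
      if (G i).graph.edist u x = (k + 1 : ℕ) then h i u x / b i u x else 0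
    have hg : ColourInvariant c g := fun {i j u v u' v'} huv => by
      simp only [g, hc.edist_eq huv, hh huv, hb huv]
    have key : ∀ i u, ∑ x, (if (G i).graph.edist u x = (k + 1 : ℕ) then h i u x else 0) =
        ∑ y, if (G i).graph.edist u y = k then ∑ x ∈ (G i).graph.nbrs y, g i u x else 0 := by
      intro i u
      have h1 : ∀ x, (if (G i).graph.edist u x = (k + 1 : ℕ) then h i u x else 0) =
          ∑ y, if (G i).graph.Adj x y then e i u y * g i u x else 0 := by
        intro x
        rw [← Finset.sum_filter, ← Finset.sum_mul]
        change _ = b i u x * g i u x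
        simp only [g]
        split_ifs with hx
        · obtain ⟨y, hy, hyk⟩ := (G i).graph.exists_adj_edist_eq hx
          have hpos : 0 < b i u x := by
            refine Finset.sum_pos' (fun z _ => ?_) ⟨y, by simpa using hy, ?_⟩
            · simp only [e]; split_ifs <;> norm_num
            · simp [e, hyk]
          field_simp
        · simp
      simp_rw [h1]
      rw [Finset.sum_comm]
      refine Finset.sum_congr rfl fun y _ => ?_
      simp only [Finset.sum_filter, e]
      split_ifs with hy
      · simp [SimpleGraph.adj_comm]
      · simp
    rw [key, key]
    exact ih (hc.sum_nbrs_eq hg) huu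

theorem sum_component_eq (hc : LocallyEquitable G c)
    {h : ∀ i, Fin (G i).n → Fin (G i).n → ℝ} (hh : ColourInvariant c h) {i j u u'}
    (huu : c i u u = c j u' u') :
    ∑ x, (if (G i).graph.edist u x = ⊤ then 0 else h i u x) =
      ∑ x, if (G j).graph.edist u' x = ⊤ then 0 else h j u' x := by
  -- `N` exceeds every finite distance from `u` and from `u'`; `toNat` sends `⊤` to `0`, which does
  -- no harm.
  let N : ℕ := ∑ x, ((G i).graph.edist u x).toNat + ∑ x, ((G j).graph.edist u' x).toNat + 1
  have key : ∀ i u, (∀ x, ((G i).graph.edist u x).toNat < N) →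
      ∑ x, (if (G i).graph.edist u x = ⊤ then 0 else h i u x) =
        ∑ k ∈ Finset.range N, ∑ x, if (G i).graph.edist u x = k then h i u x else 0 := by
    intro i u hN
    rw [Finset.sum_comm]
    refine Finset.sum_congr rfl fun x _ => ?_
    split_ifs with hx
    · simp [hx]
    · obtain ⟨m, hm⟩ := ENat.ne_top_iff_exists.1 hx
      have hN := hN x
      rw [← hm] at hN ⊢
      simp only [ENat.toNat_natCast] at hN
      simp [hN]
  rw [key i u fun x => ?_, key j u' fun x => ?_]
  · exact Finset.sum_congr rfl fun k _ => hc.sum_edist_eq k hh huu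
  · have := Finset.single_le_sum (f := fun x => ((G j).graph.edist u' x).toNat)
      (fun _ _ => Nat.zero_le _) (Finset.mem_univ x)
    simp only [N]; omega
  · have := Finset.single_le_sum (f := fun x => ((G i).graph.edist u x).toNat)
      (fun _ _ => Nat.zero_le _) (Finset.mem_univ x)
    simp only [N]; omega

/-! ### Merging the colours of pairs in different components -/

/-- The colouring that agrees with `c` on the pairs of nodes in the same component, and remembers of
other pairs only the colours of the two nodes. -/
def splitColour (G : ι → FeatGraph d) (c : ∀ i, Fin (G i).n → Fin (G i).n → K) (i : ι)
    (u v : Fin (G i).n) : K ⊕ K × K :=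
  if (G i).graph.edist u v = ⊤ then .inr (c i u u, c i v v) else .inl (c i u v)

theorem splitColour_invariant (hc : LocallyEquitable G c) :
    ColourInvariant c (splitColour G c) := fun {i j u v u' v'} h => by
  simp only [splitColour, hc.edist_eq h, hc.left h, hc.right h, h]

theorem splitColour_eq {i j u v u' v'}
    (h : splitColour G c i u v = splitColour G c j u' v') :
    c i u v = c j u' v' ∨ (G i).graph.edist u v = ⊤ ∧ (G j).graph.edist u' v' = ⊤ ∧
      c i u u = c j u' u' ∧ c i v v = c j v' v' := by
  unfold splitColour at h
  split_ifs at h with h1 h2 h2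
  · simp only [Sum.inr.injEq, Prod.mk.injEq] at h
    exact Or.inr ⟨h1, h2, h⟩
  · simp only [Sum.inl.injEq] at h
    exact Or.inl h

theorem splitColour_eq_of_eq_top {i j u v u' v'} (h1 : (G i).graph.edist u v = ⊤)
    (h2 : (G j).graph.edist u' v' = ⊤) (hu : c i u u = c j u' u') (hv : c i v v = c j v' v') :
    splitColour G c i u v = splitColour G c j u' v' := by
  simp only [splitColour, h1, h2, hu, hv, if_true]

theorem splitColour_locallyEquitable (hc : LocallyEquitable G c) :
    LocallyEquitable G (splitColour G c) where
  feat h := by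
    rcases splitColour_eq h with h | ⟨-, -, -, h⟩
    · exact hc.feat h
    · exact hc.feat h
  eq_iff {i j u v u' v'} h := by
    rcases splitColour_eq h with h | ⟨h1, h2, -, -⟩
    · exact hc.eq_iff h
    · constructor
      · rintro rfl; simp at h1
      · rintro rfl; simp at h2
  left h := by
    rcases splitColour_eq h with h | ⟨-, -, h, -⟩
    · exact hc.splitColour_invariant (hc.left h)
    · exact hc.splitColour_invariant h
  right h := by
    rcases splitColour_eq h with h | ⟨-, -, -, h⟩
    · exact hc.splitColour_invariant (hc.right h)
    · exact hc.splitColour_invariant h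
  nbrs_right h := by
    rcases splitColour_eq h with h | ⟨h1, h2, hu, hv⟩
    · exact Multiset.map_eq_map_of_map_eq (hc.nbrs_right h)
        fun _ _ _ _ e => hc.splitColour_invariant e
    -- Neighbours of `v` stay outside the component of `u`, so only their diagonal colours matter;
    -- these are known from the colours of the pairs `(v, x)`.
    · refine Multiset.map_eq_map_of_map_eq (hc.nbrs_right hv) fun x hx y hy e => ?_
      exact splitColour_eq_of_eq_top
        (SimpleGraph.edist_eq_top_of_adj _ (by simpa using hx) h1)
        (SimpleGraph.edist_eq_top_of_adj _ (by simpa using hy) h2) hu (hc.right e)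
  nbrs_left h := by
    rcases splitColour_eq h with h | ⟨h1, h2, hu, hv⟩
    · exact Multiset.map_eq_map_of_map_eq (hc.nbrs_left h)
        fun _ _ _ _ e => hc.splitColour_invariant e
    · refine Multiset.map_eq_map_of_map_eq (hc.nbrs_right hu) fun x hx y hy e => ?_
      rw [SimpleGraph.edist_comm] at h1 h2
      refine splitColour_eq_of_eq_top ?_ ?_ (hc.right e) hv
      · rw [SimpleGraph.edist_comm]
        exact SimpleGraph.edist_eq_top_of_adj _ (by simpa using hx) h1
      · rw [SimpleGraph.edist_comm]
        exact SimpleGraph.edist_eq_top_of_adj _ (by simpa using hy) h2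

theorem splitColour_sameDiagonals (hc : LocallyEquitable G c) (hd : SameDiagonals G c) :
    SameDiagonals G (splitColour G c) := fun i j =>
  Multiset.map_eq_map_of_map_eq (hd i j) fun _ _ _ _ e => hc.splitColour_invariant e

theorem splitColour_globallyEquitable (hc : LocallyEquitable G c) (hd : SameDiagonals G c) :
    GloballyEquitable G (splitColour G c) := by
  intro i j u u' h
  have huu : c i u u = c j u' u' := by
    rcases splitColour_eq h with h | ⟨-, -, h, -⟩ <;> exact h
  refine Multiset.map_eq_map_of_forall_sum_ite_eq fun z => ?_
  -- `p` treats every `w` as if it lay outside the component of `u`; its sum depends only on `c u u`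
  -- and the diagonal multiset. The error `h` is needed only inside the component, where
  -- `sum_component_eq` applies.
  let p : ∀ i, Fin (G i).n → Fin (G i).n → ℝ := fun i u w =>
    if Sum.inr (c i u u, c i w w) = z then 1 else 0
  let h : ∀ i, Fin (G i).n → Fin (G i).n → ℝ := fun i u w =>
    (if splitColour G c i u w = z then 1 else 0) - p i u w
  have hh : ColourInvariant c h := fun {i j u v u' v'} e => by
    simp only [h, p, hc.splitColour_invariant e, hc.left e, hc.right e]
  have key : ∀ i u, ∑ w, (if splitColour G c i u w = z then (1 : ℝ) else 0) =
      ∑ w, p i u w + ∑ w, if (G i).graph.edist u w = ⊤ then 0 else h i u w := by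
    intro i u
    rw [← Finset.sum_add_distrib]
    refine Finset.sum_congr rfl fun w _ => ?_
    by_cases hw : (G i).graph.edist u w = ⊤
    · simp [hw, p, splitColour]
    · simp [hw, h]
  rw [key, key, hc.sum_component_eq hh huu]
  congr 1
  refine congrArg Multiset.sum (Multiset.map_eq_map_of_map_eq (hd i j) fun _ _ _ _ e => ?_)
  simp only [p, huu, e]

end LocallyEquitable

/-! ### Node-based subgraph GNNs respect equitable colourings -/

variable {G : ι → FeatGraph d} {c : ∀ i, Fin (G i).n → Fin (G i).n → K}

/-- The colour of `(u, v)` determines the values at `(u, v)` and at `(v, u)`. -/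
def RespectsColour (c : ∀ i, Fin (G i).n → Fin (G i).n → K) {α : Type}
    (X : ∀ i, Fin (G i).n → Fin (G i).n → α) : Prop :=
  ColourInvariant c X ∧ ColourInvariant c fun i u v => X i v u

theorem RespectsColour.map_univ_eq (hg : GloballyEquitable G c) {α : Type}
    {X : ∀ i, Fin (G i).n → Fin (G i).n → α} (hX : RespectsColour c X) {i j u u'}
    (h : c i u u = c j u' u') :
    ((Finset.univ.val.map fun w => X i u w) = Finset.univ.val.map fun w => X j u' w) ∧
      (Finset.univ.val.map fun w => X i w u) = Finset.univ.val.map fun w => X j w u' :=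
  ⟨Multiset.map_eq_map_of_map_eq (hg h) fun _ _ _ _ e => hX.1 e,
    Multiset.map_eq_map_of_map_eq (hg h) fun _ _ _ _ e => hX.2 e⟩

/-- A layer reads `X v u` as well as `X u v`, and the colouring need not be symmetric. Invariance of
`X` and of its transpose must therefore be carried along together. -/
theorem RespectsColour.update (hc : LocallyEquitable G c) (hg : GloballyEquitable G c) {p q : ℕ}
    (L : NodeLayer p q) {X : ∀ i, Fin (G i).n → Fin (G i).n → Vec p} (hX : RespectsColour c X) :
    RespectsColour c fun i => L.update (G i).graph (X i) := by
  constructor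
  · intro i j u v u' v' h
    have h2 : X i v u = X j v' u' := hX.2 h
    simp only [NodeLayer.update]
    rw [hX.1 h, h2, hX.1 (hc.left h), hX.1 (hc.right h),
      (hX.map_univ_eq hg (hc.left h)).1, (hX.map_univ_eq hg (hc.right h)).2,
      Multiset.map_eq_map_of_map_eq (hc.nbrs_right h) fun _ _ _ _ e => hX.1 e,
      Multiset.map_eq_map_of_map_eq (hc.nbrs_left h) fun _ _ _ _ e => hX.1 e]
  · intro i j u v u' v' h
    have h2 : X i v u = X j v' u' := hX.2 h
    simp only [NodeLayer.update]
    rw [hX.1 h, h2, hX.1 (hc.left h), hX.1 (hc.right h),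
      (hX.map_univ_eq hg (hc.left h)).2, (hX.map_univ_eq hg (hc.right h)).1,
      Multiset.map_eq_map_of_map_eq (hc.nbrs_right h) fun _ _ _ _ e => hX.2 e,
      Multiset.map_eq_map_of_map_eq (hc.nbrs_left h) fun _ _ _ _ e => hX.2 e]

theorem RespectsColour.run (hc : LocallyEquitable G c) (hg : GloballyEquitable G c) {p q : ℕ}
    (L : NodeStack p q) : ∀ {X : ∀ i, Fin (G i).n → Fin (G i).n → Vec p}, RespectsColour c X →
      RespectsColour c fun i => L.run (G i).graph (X i) := by
  induction L with
  | nil => exact fun hX => hX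
  | cons L rest ih => exact fun hX => ih (hX.update hc hg L)

theorem NodeGNN.respectsColour_init (hc : LocallyEquitable G c) {o : ℕ} (M : NodeGNN d o) :
    RespectsColour c fun i => M.init (G i) := by
  constructor
  · intro i j u v u' v' h
    simp only [NodeGNN.init, hc.feat h, hc.edist_eq h]
  · intro i j u v u' v' h
    have he : (G i).graph.edist v u = (G j).graph.edist v' u' := by
      rw [SimpleGraph.edist_comm, SimpleGraph.edist_comm (u := v')]
      exact hc.edist_eq h
    simp only [NodeGNN.init, hc.feat (hc.left h), he]

theorem NodeGNN.eval_eq_of_equitable (hc : LocallyEquitable G c) (hg : GloballyEquitable G c)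
    (hd : SameDiagonals G c) {o : ℕ} (M : NodeGNN d o) (i j : ι) : M.eval (G i) = M.eval (G j) := by
  have hX : RespectsColour c fun i => M.final (G i) :=
    (M.respectsColour_init hc).run hc hg M.layers
  have h1 : ∑ u, M.mlp₁.eval (∑ v, M.final (G i) u v) =
      ∑ u, M.mlp₁.eval (∑ v, M.final (G j) u v) :=
    congrArg Multiset.sum (Multiset.map_eq_map_of_map_eq (hd i j) fun _ _ _ _ e =>
      congrArg M.mlp₁.eval (congrArg Multiset.sum (hX.map_univ_eq hg e).1))
  have h2 : ∑ v, M.mlp₁.eval (∑ u, M.final (G i) u v) =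
      ∑ v, M.mlp₁.eval (∑ u, M.final (G j) u v) :=
    congrArg Multiset.sum (Multiset.map_eq_map_of_map_eq (hd i j) fun _ _ _ _ e =>
      congrArg M.mlp₁.eval (congrArg Multiset.sum (hX.map_univ_eq hg e).2))
  simp only [NodeGNN.eval, h1, h2]

end

/-! ### Continuous functions and aggregations on finite sets of features -/

theorem Set.Finite.exists_continuous_extension {α : Type} [TopologicalSpace α] [NormalSpace α]
    [T1Space α] {F : Set α} (hF : F.Finite) {q : ℕ} (g : α → Vec q) :
    ∃ f : α → Vec q, Continuous f ∧ ∀ x ∈ F, f x = g x := by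
  have : Finite F := hF
  obtain ⟨f, hf⟩ := ContinuousMap.exists_restrict_eq hF.isClosed
    (⟨fun x : F => g x, continuous_of_discreteTopology⟩ : C(F, Vec q))
  exact ⟨f, f.continuous, fun x hx => congrArg (fun h => h ⟨x, hx⟩) hf⟩

/-- Sum aggregation of a continuous function of the entries. -/
def Agg.sumMap {α : Type} [TopologicalSpace α] {k : ℕ} (φ : α → Vec k) (hφ : Continuous φ) :
    Agg α k where
  toFun s := (s.map φ).sum
  continuous_toFun m := by
    simp only [Multiset.map_map, Function.comp_def]
    exact continuous_finsetSum (Finset.univ : Finset (Fin m)) fun i _ => hφ.comp (continuous_apply i)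

/-- By Tietze, the indicator vectors of the points of `F` extend continuously; summing them counts
multiplicities. -/
theorem exists_agg_injOn {α : Type} [TopologicalSpace α] [NormalSpace α] [T1Space α] {F : Set α}
    (hF : F.Finite) : ∃ (k : ℕ) (A : Agg α k), ∀ s t : Multiset α, (∀ x ∈ s, x ∈ F) →
      (∀ x ∈ t, x ∈ F) → A.toFun s = A.toFun t → s = t := by
  have : Finite F := hF
  obtain ⟨k, ⟨e⟩⟩ := Finite.exists_equiv_fin F
  obtain ⟨φ, hφ, hφF⟩ := hF.exists_continuous_extension
    fun x (a : Fin k) => if x = (e.symm a : α) then (1 : ℝ) else 0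
  have key : ∀ s : Multiset α, (∀ x ∈ s, x ∈ F) → ∀ a : Fin k,
      (Agg.sumMap φ hφ).toFun s a = (s.count (e.symm a : α) : ℝ) := by
    intro s hs a
    change (s.map φ).sum a = _
    induction s using Multiset.induction_on with
    | empty => simp
    | cons x s ih =>
      rw [Multiset.map_cons, Multiset.sum_cons, Pi.add_apply,
        ih fun y hy => hs y (Multiset.mem_cons_of_mem hy), hφF x (hs x (Multiset.mem_cons_self x s)),
        Multiset.count_cons]
      simp only [eq_comm (a := x)]
      push_cast
      ring
  refine ⟨k, Agg.sumMap φ hφ, fun s t hs ht h => ?_⟩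
  ext x
  by_cases hx : x ∈ F
  · have h1 := congrFun h (e ⟨x, hx⟩)
    rw [key s hs, key t ht] at h1
    simpa using h1
  · rw [Multiset.count_eq_zero_of_notMem fun h => hx (hs x h),
      Multiset.count_eq_zero_of_notMem fun h => hx (ht x h)]

/-! ### The signature of a pair (super-node, node) -/

/-- All that a CS-GNN layer can read at `(S, v)`: the value there, and the four multisets that are
aggregated. -/
def csSignature (T : Coarsening) {n p : ℕ} (G : SimpleGraph (Fin n))
    (X : Finset (Fin n) → Fin n → Vec p) (S : Finset (Fin n)) (v : Fin n) :
    Vec p × Multiset (Vec p) × Multiset (Vec p) × Multiset (Vec p × Vec 8) ×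
      Multiset (Vec p × Vec 8) :=
  (X S v, (Finset.univ.filter fun v' => G.Adj v v').val.map fun v' => X S v',
    ((T n G).filter fun S' => CoarseAdj G S S').val.map fun S' => X S' v,
    ((T n G).filter fun S' => v ∈ S').val.map fun S' => (X S' v, orbitCode S v S' v),
    S.val.map fun v' => (X S v', orbitCode S v S v'))

section

variable {ι : Type} [Finite ι] {d : ℕ} {G : ι → FeatGraph d} {T : Coarsening}

/-- Only finitely many features occur, so the aggregations can be chosen injective on the multisets
that arise, and any function of the signature extends continuously. -/
theorem CSLayer.exists_update_eq {p q : ℕ}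
    (X : ∀ i, Finset (Fin (G i).n) → Fin (G i).n → Vec p)
    (Y : ∀ i, Finset (Fin (G i).n) → Fin (G i).n → Vec q)
    (hY : ∀ i j S v S' v', csSignature T (G i).graph (X i) S v =
      csSignature T (G j).graph (X j) S' v' → Y i S v = Y j S' v') :
    ∃ L : CSLayer p q, ∀ i S v, L.update T (G i).graph (X i) S v = Y i S v := by
  let Ω := Σ i, Finset (Fin (G i).n) × Fin (G i).n
  have hF : (Set.range fun ω : Ω => X ω.1 ω.2.1 ω.2.2).Finite := Set.finite_range _
  have hF' : (Set.range fun ω : (Σ i, (Finset (Fin (G i).n) × Fin (G i).n) ×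
      Finset (Fin (G i).n) × Fin (G i).n) =>
        (X ω.1 ω.2.2.1 ω.2.2.2, orbitCode ω.2.1.1 ω.2.1.2 ω.2.2.1 ω.2.2.2)).Finite :=
    Set.finite_range _
  obtain ⟨k, A, hA⟩ := exists_agg_injOn hF
  obtain ⟨k', A', hA'⟩ := exists_agg_injOn hF'
  let z : Ω → Vec p × Vec k × Vec k × Vec k' × Vec k' := fun ω =>
    let s := csSignature T (G ω.1).graph (X ω.1) ω.2.1 ω.2.2
    (s.1, A.toFun s.2.1, A.toFun s.2.2.1, A'.toFun s.2.2.2.1, A'.toFun s.2.2.2.2)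
  have hz : Function.FactorsThrough (fun ω : Ω => Y ω.1 ω.2.1 ω.2.2) z := by
    rintro ⟨i, S, v⟩ ⟨j, S', v'⟩ h
    refine hY i j S v S' v' ?_
    simp only [z, Prod.mk.injEq] at h
    obtain ⟨h0, h1, h2, h3, h4⟩ := h
    refine Prod.ext h0 (Prod.ext (hA _ _ ?_ ?_ h1) (Prod.ext (hA _ _ ?_ ?_ h2)
      (Prod.ext (hA' _ _ ?_ ?_ h3) (hA' _ _ ?_ ?_ h4)))) <;> intro x hx <;>
      dsimp only [csSignature] at hx <;> obtain ⟨y, -, rfl⟩ := Multiset.mem_map.1 hx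
    · exact ⟨⟨i, S, y⟩, rfl⟩
    · exact ⟨⟨j, S', y⟩, rfl⟩
    · exact ⟨⟨i, y, v⟩, rfl⟩
    · exact ⟨⟨j, y, v'⟩, rfl⟩
    · exact ⟨⟨i, (S, v), y, v⟩, rfl⟩
    · exact ⟨⟨j, (S', v'), y, v'⟩, rfl⟩
    · exact ⟨⟨i, (S, v), S, y⟩, rfl⟩
    · exact ⟨⟨j, (S', v'), S', y⟩, rfl⟩
  obtain ⟨f, hf, hfz⟩ := (Set.finite_range z).exists_continuous_extension
    (Function.extend z (fun ω : Ω => Y ω.1 ω.2.1 ω.2.2) 0)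
  refine ⟨⟨k, k, k', k', A, A, A', A', f, hf⟩, fun i S v => ?_⟩
  exact (hfz (z ⟨i, S, v⟩) ⟨_, rfl⟩).trans (hz.extend_apply 0 ⟨i, S, v⟩)

/-- Add a layer at the end of a stack. -/
def CSStack.snoc : {p q r : ℕ} → CSStack p q → CSLayer q r → CSStack p r
  | _, _, _, .nil, L => .cons L .nil
  | _, _, _, .cons L' rest, L => .cons L' (rest.snoc L)

theorem CSStack.run_snoc {n p q r : ℕ} (G : SimpleGraph (Fin n)) (s : CSStack p q)
    (L : CSLayer q r) (X : Finset (Fin n) → Fin n → Vec p) :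
    (s.snoc L).run T G X = L.update T G (s.run T G X) := by
  induction s with
  | nil => rfl
  | cons L' rest ih => exact ih L _

/-- The features that a stack of layers computes from the simple node marking. -/
def CSStack.features (T : Coarsening) (G : ι → FeatGraph d) {r : ℕ} (s : CSStack (d + 1) r) (i : ι) :
    Finset (Fin (G i).n) → Fin (G i).n → Vec r :=
  s.run T (G i).graph (simpleMarking (G i))

theorem CSStack.exists_snoc_features_eq {r q : ℕ} (s : CSStack (d + 1) r)
    (Y : ∀ i, Finset (Fin (G i).n) → Fin (G i).n → Vec q)
    (hY : ∀ i j S v S' v', csSignature T (G i).graph (s.features T G i) S v =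
      csSignature T (G j).graph (s.features T G j) S' v' → Y i S v = Y j S' v') :
    ∃ L : CSLayer r q, ∀ i S v, (s.snoc L).features T G i S v = Y i S v := by
  obtain ⟨L, hL⟩ := CSLayer.exists_update_eq (s.features T G) Y hY
  exact ⟨L, fun i S v => by rw [← hL]; unfold features; rw [run_snoc]⟩

/-- There is a stack of layers whose features determine the initial marking, and that no further
layer can refine. -/
theorem CSStack.exists_stable (T : Coarsening) (G : ι → FeatGraph d) :
    ∃ (r : ℕ) (s : CSStack (d + 1) r),
      (∀ i j S v S' v', s.features T G i S v = s.features T G j S' v' →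
        simpleMarking (G i) S v = simpleMarking (G j) S' v') ∧
      ∀ i j S v S' v', s.features T G i S v = s.features T G j S' v' →
        csSignature T (G i).graph (s.features T G i) S v =
          csSignature T (G j).graph (s.features T G j) S' v' := by
  let Ω := Σ i, Finset (Fin (G i).n) × Fin (G i).n
  let ker : (Σ r, CSStack (d + 1) r) → Set (Ω × Ω) := fun s =>
    {w | s.2.features T G w.1.1 w.1.2.1 w.1.2.2 = s.2.features T G w.2.1 w.2.2.1 w.2.2.2}
  let ker₀ : Set (Ω × Ω) :=
    {w | simpleMarking (G w.1.1) w.1.2.1 w.1.2.2 = simpleMarking (G w.2.1) w.2.2.1 w.2.2.2}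
  -- Take a stack whose kernel is minimal among those refining the initial marking. One more layer,
  -- numbering the signatures, refines the kernel further, so by minimality it changes nothing.
  obtain ⟨κ, ⟨⟨⟨r, s⟩, rfl⟩, hκ₀⟩, hmin⟩ := (Set.toFinite {κ | κ ∈ Set.range ker ∧ κ ≤ ker₀}).exists_minimal
    ⟨ker ⟨_, .nil⟩, ⟨_, rfl⟩, le_refl _⟩
  refine ⟨r, s, fun i j S v S' v' h => @hκ₀ (⟨i, S, v⟩, ⟨j, S', v'⟩) h, fun i j S v S' v' h => ?_⟩
  let sig : Ω → _ := fun ω => csSignature T (G ω.1).graph (s.features T G ω.1) ω.2.1 ω.2.2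
  obtain ⟨m, ⟨e⟩⟩ := Finite.exists_equiv_fin (Set.range sig)
  obtain ⟨L, hL⟩ := s.exists_snoc_features_eq (T := T) (G := G)
    (fun i S v (_ : Fin 1) => ((e ⟨sig ⟨i, S, v⟩, _, rfl⟩ : ℕ) : ℝ)) (by
      intro i j S v S' v' h
      have : sig ⟨i, S, v⟩ = sig ⟨j, S', v'⟩ := h
      simp only [this])
  have hsig : ∀ w : Ω × Ω, w ∈ ker ⟨1, s.snoc L⟩ → sig w.1 = sig w.2 := by
    rintro ⟨⟨i, S, v⟩, ⟨j, S', v'⟩⟩ hw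
    simp only [ker, Set.mem_ofPred_eq, hL] at hw
    have hw := congrFun hw 0
    exact congrArg Subtype.val (e.injective (Fin.ext (by exact_mod_cast hw)))
  have hle : ker ⟨1, s.snoc L⟩ ≤ ker ⟨r, s⟩ := fun w hw => congrArg Prod.fst (hsig w hw)
  exact hsig (⟨i, S, v⟩, ⟨j, S', v'⟩) (hmin ⟨⟨_, rfl⟩, hle.trans hκ₀⟩ hle h)

end

/-! ### Node colours from stable features -/

theorem ind_eq_iff {p q : Prop} : ind p = ind q ↔ (p ↔ q) := by
  by_cases hp : p <;> by_cases hq : q <;> simp [ind, hp, hq]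

theorem simpleMarking_eq_iff {d : ℕ} {G G' : FeatGraph d} {S v S' v'} :
    simpleMarking G S v = simpleMarking G' S' v' ↔
      G.feat v = G'.feat v' ∧ (v ∈ S ↔ v' ∈ S') := by
  simp only [simpleMarking, Fin.snoc_inj, ind_eq_iff]

theorem singleton_mem_singletonsAndEdges {n : ℕ} (G : SimpleGraph (Fin n)) (v : Fin n) :
    {v} ∈ singletonsAndEdges n G := by
  simp [singletonsAndEdges]

/-- Features that determine the initial marking and their own signatures. -/
structure StableFeatures {ι : Type} {d r : ℕ} (G : ι → FeatGraph d)
    (X : ∀ i, Finset (Fin (G i).n) → Fin (G i).n → Vec r) : Prop where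
  marking : ∀ {i j S v S' v'}, X i S v = X j S' v' →
    simpleMarking (G i) S v = simpleMarking (G j) S' v'
  signature : ∀ {i j S v S' v'}, X i S v = X j S' v' →
    csSignature singletonsAndEdges (G i).graph (X i) S v =
      csSignature singletonsAndEdges (G j).graph (X j) S' v'

namespace StableFeatures

variable {ι : Type} {d r : ℕ} {G : ι → FeatGraph d}
  {X : ∀ i, Finset (Fin (G i).n) → Fin (G i).n → Vec r}

/-- The fourth aggregated multiset has one entry for each element of `S`. -/
theorem card_eq (hX : StableFeatures G X) {i j S v S' v'} (h : X i S v = X j S' v') :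
    S.card = S'.card := by
  have := congrArg Multiset.card (congrArg (fun s => s.2.2.2.2) (hX.signature h))
  simpa [csSignature] using this

theorem mem_iff (hX : StableFeatures G X) {i j S v S' v'} (h : X i S v = X j S' v') :
    v ∈ S ↔ v' ∈ S' :=
  (simpleMarking_eq_iff.1 (hX.marking h)).2

theorem nbrs_eq_map {n : ℕ} (G : SimpleGraph (Fin n)) {α : Type} (X : Finset (Fin n) → Fin n → α)
    (u v : Fin n) :
    (((singletonsAndEdges n G).filter fun S => CoarseAdj G {u} S).val.filter
      fun S => S.card = 1).map (fun S => X S v) = (G.nbrs u).val.map fun x => X {x} v := by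
  have : (((singletonsAndEdges n G).filter fun S => CoarseAdj G {u} S).filter fun S => S.card = 1) =
      (G.nbrs u).map ⟨fun x => {x}, Finset.singleton_injective⟩ := by
    ext S
    simp only [Finset.mem_filter, Finset.mem_map, Finset.mem_univ, true_and,
      Function.Embedding.coeFn_mk, Finset.card_eq_one]
    constructor
    · rintro ⟨⟨-, h⟩, x, rfl⟩
      exact ⟨x, by simpa [CoarseAdj] using h, rfl⟩
    · rintro ⟨x, hx, rfl⟩
      exact ⟨⟨singleton_mem_singletonsAndEdges G x, by simpa [CoarseAdj] using hx⟩, x, rfl⟩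
  rw [← Finset.filter_val, this, Finset.map_val, Multiset.map_map]
  rfl

theorem filter_mem_eq {n : ℕ} (G : SimpleGraph (Fin n)) (v : Fin n) :
    ((singletonsAndEdges n G).filter fun S => v ∈ S).val.filter (fun S => S.card = 1) =
      {{v}} := by
  have : (((singletonsAndEdges n G).filter fun S => v ∈ S).filter fun S => S.card = 1) = {{v}} := by
    ext S
    simp only [Finset.mem_filter, Finset.mem_singleton, Finset.card_eq_one]
    constructor
    · rintro ⟨⟨-, h⟩, x, rfl⟩
      rw [Finset.mem_singleton.1 h]
    · rintro rfl
      exact ⟨⟨singleton_mem_singletonsAndEdges G v, by simp⟩, v, rfl⟩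
  rw [← Finset.filter_val, this]
  rfl

/-- The four aggregations supply `nbrs_right`, `nbrs_left`, `right` and `left` in this order. In the
second and third, super-nodes of size one are selected by `card_eq`; the only one containing `v` is
`{v}`. -/
theorem locallyEquitable (hX : StableFeatures G X) :
    LocallyEquitable G fun i u v => X i {u} v where
  feat h := (simpleMarking_eq_iff.1 (hX.marking h)).1
  eq_iff h := by
    have := hX.mem_iff h
    simp only [Finset.mem_singleton] at this
    rw [eq_comm, this, eq_comm]
  left h := by
    have := congrArg (fun s => s.2.2.2.2) (hX.signature h)
    simp only [csSignature, Finset.singleton_val, Multiset.map_singleton, Multiset.singleton_inj,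
      Prod.mk.injEq] at this
    exact this.1
  right {i j u v u' v'} h := by
    have h1 := congrArg (fun s => s.2.2.2.1) (hX.signature h)
    dsimp only [csSignature] at h1
    have h2 := Multiset.map_filter_eq_of_map_eq (p := fun S : Finset (Fin (G i).n) => S.card = 1)
      (q := fun S : Finset (Fin (G j).n) => S.card = 1) h1 fun S _ S' _ e => by
        rw [hX.card_eq (congrArg Prod.fst e)]
    rw [filter_mem_eq, filter_mem_eq] at h2
    simp only [Multiset.map_singleton, Multiset.singleton_inj, Prod.mk.injEq] at h2
    exact h2.1
  nbrs_right h := congrArg (fun s => s.2.1) (hX.signature h)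
  nbrs_left {i j u v u' v'} h := by
    have h1 := congrArg (fun s => s.2.2.1) (hX.signature h)
    dsimp only [csSignature] at h1
    have h2 := Multiset.map_filter_eq_of_map_eq (p := fun S : Finset (Fin (G i).n) => S.card = 1)
      (q := fun S : Finset (Fin (G j).n) => S.card = 1) h1 fun S _ S' _ e => by rw [hX.card_eq e]
    rwa [nbrs_eq_map, nbrs_eq_map] at h2

end StableFeatures

/-! ### Reading off the multiset of diagonal colours -/

theorem sum_singletonsAndEdges_ite {n : ℕ} (G : SimpleGraph (Fin n)) {α : Type} [DecidableEq α]
    (X : Finset (Fin n) → Fin n → α) (y : α) :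
    ∑ S ∈ singletonsAndEdges n G, ∑ v, (if S = {v} ∧ X S v = y then (1 : ℝ) else 0) =
      ∑ v, if X {v} v = y then 1 else 0 := by
  rw [Finset.sum_comm]
  refine Finset.sum_congr rfl fun v _ => ?_
  rw [Finset.sum_eq_single {v}]
  · simp
  · intro S _ hS
    simp [hS]
  · exact fun h => absurd (singleton_mem_singletonsAndEdges G v) h

/-- A last layer marks the pairs `({v}, v)` of colour `y`, recognisable from `S.card` and `v ∈ S`.
Pooling counts them, and the all-ones matrix copies the count into each output coordinate. -/
theorem CSStack.exists_eval_eq_sum {ι : Type} [Finite ι] {d o r : ℕ} {G : ι → FeatGraph d}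
    (s : CSStack (d + 1) r) (hs : StableFeatures G (s.features singletonsAndEdges G)) (y : Vec r) :
    ∃ M : CSGNN d o, ∀ i a, M.eval singletonsAndEdges (G i) a =
      ∑ v, if s.features singletonsAndEdges G i {v} v = y then 1 else 0 := by
  obtain ⟨L, hL⟩ := s.exists_snoc_features_eq (T := singletonsAndEdges) (G := G)
    (fun i S v (_ : Fin 1) =>
      if S = {v} ∧ s.features singletonsAndEdges G i S v = y then (1 : ℝ) else 0) (by
      intro i j S v S' v' h
      have h : s.features singletonsAndEdges G i S v = s.features singletonsAndEdges G j S' v' :=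
        congrArg Prod.fst h
      have key : ∀ {n : ℕ} (S : Finset (Fin n)) v, S = {v} ↔ S.card = 1 ∧ v ∈ S := by
        intro n S v
        rw [Finset.card_eq_one]
        constructor
        · rintro rfl; simp
        · rintro ⟨⟨x, rfl⟩, hv⟩
          rw [Finset.mem_singleton.1 hv]
      simp only [key, hs.card_eq h, hs.mem_iff h, h])
  refine ⟨⟨1, 1, s.snoc L, .affine 1 0, .affine (Matrix.of fun _ _ => 1) 0⟩, fun i a => ?_⟩
  rw [← sum_singletonsAndEdges_ite (G i).graph]
  have hL' : ∀ S v, (s.snoc L).run singletonsAndEdges (G i).graph (simpleMarking (G i)) S v = _ :=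
    hL i
  simp [CSGNN.eval, MLP.eval, hL', Matrix.mulVec, dotProduct, Finset.sum_apply]

theorem NodeGNN.eval_eq_of_csgnn_eval_eq {d o : ℕ} {G₁ G₂ : FeatGraph d}
    (h : ∀ M : CSGNN d o, M.eval singletonsAndEdges G₁ = M.eval singletonsAndEdges G₂)
    (M : NodeGNN d o) : M.eval G₁ = M.eval G₂ := by
  -- The coordinate `a` guarantees an output from which counts can be read; for `o = 0` there is
  -- nothing to prove.
  ext a
  let G : Bool → FeatGraph d := fun b => if b then G₁ else G₂
  obtain ⟨r, s, hs₀, hs⟩ := CSStack.exists_stable singletonsAndEdges G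
  have hX : StableFeatures G (s.features singletonsAndEdges G) :=
    ⟨fun h => hs₀ _ _ _ _ _ _ h, fun h => hs _ _ _ _ _ _ h⟩
  have hd : SameDiagonals G fun i u v => s.features singletonsAndEdges G i {u} v := by
    intro i j
    refine Multiset.map_eq_map_of_forall_sum_ite_eq fun y => ?_
    obtain ⟨M, hM⟩ := s.exists_eval_eq_sum (o := o) hX y
    have hij : M.eval singletonsAndEdges (G i) = M.eval singletonsAndEdges (G j) := by
      cases i <;> cases j
      · rfl
      · exact (h M).symm
      · exact h M
      · rfl
    rw [← hM i a, ← hM j a, hij]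
  exact congrFun (M.eval_eq_of_equitable hX.locallyEquitable.splitColour_locallyEquitable
    (hX.locallyEquitable.splitColour_globallyEquitable hd)
    (hX.locallyEquitable.splitColour_sameDiagonals hd) true false) a

/-! ### A CS-GNN that detects complete subgraphs on four nodes -/

/-- The number of neighbours of `v` in `S`. -/
def neighboursIn {n : ℕ} (G : SimpleGraph (Fin n)) (S : Finset (Fin n)) (v : Fin n) : ℕ :=
  ((G.nbrs v).filter fun x => x ∈ S).card

/-- The number of ordered pairs of distinct neighbours of `v` in `S`. -/
def neighbourPairsIn {n : ℕ} (G : SimpleGraph (Fin n)) (S : Finset (Fin n)) (v : Fin n) : ℝ :=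
  neighboursIn G S v * (neighboursIn G S v - 1)

theorem neighbourPairsIn_nonneg {n : ℕ} (G : SimpleGraph (Fin n)) (S : Finset (Fin n)) (v : Fin n) :
    0 ≤ neighbourPairsIn G S v := by
  unfold neighbourPairsIn
  rcases Nat.eq_zero_or_pos (neighboursIn G S v) with h | h
  · simp [h]
  · have : (1 : ℝ) ≤ neighboursIn G S v := by exact_mod_cast h
    exact mul_nonneg (by linarith) (by linarith)

theorem neighbourPairsIn_pair {n : ℕ} {G : SimpleGraph (Fin n)} {a b v : Fin n} (hab : a ≠ b)
    (ha : G.Adj v a) (hb : G.Adj v b) : neighbourPairsIn G {a, b} v = 2 := by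
  have : (G.nbrs v).filter (fun x => x ∈ ({a, b} : Finset (Fin n))) = {a, b} := by
    ext x
    simp only [Finset.mem_filter, Finset.mem_univ, true_and, Finset.mem_insert,
      Finset.mem_singleton, and_iff_right_iff_imp]
    rintro (rfl | rfl) <;> assumption
  rw [neighbourPairsIn, neighboursIn, this, Finset.card_pair hab]
  norm_num

/-- `m * (m - 1)` vanishes for `m = 0, 1`, and super-nodes have at most two elements; so a nonzero
value forces an edge with both ends adjacent to `v`. -/
theorem adj_of_neighbourPairsIn_ne_zero {n : ℕ} {G : SimpleGraph (Fin n)} {S : Finset (Fin n)}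
    {v : Fin n} (hS : S ∈ singletonsAndEdges n G) (h : neighbourPairsIn G S v ≠ 0) :
    (∃ a b, G.Adj a b ∧ S = {a, b}) ∧ ∀ x ∈ S, G.Adj v x := by
  have h2 : 2 ≤ neighboursIn G S v := by
    by_contra hlt
    have : neighboursIn G S v = 0 ∨ neighboursIn G S v = 1 := by omega
    rcases this with h' | h' <;> simp [neighbourPairsIn, h'] at h
  have hsub : (G.nbrs v).filter (fun x => x ∈ S) ⊆ S := fun x hx => (Finset.mem_filter.1 hx).2
  have hle : 2 ≤ S.card := h2.trans (Finset.card_le_card hsub)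
  rcases (Finset.mem_filter.1 hS).2 with ⟨u, rfl⟩ | ⟨a, b, hab, rfl⟩
  · simp at hle
  · refine ⟨⟨a, b, hab, rfl⟩, fun x hx => ?_⟩
    rw [← Finset.eq_of_subset_of_card_le hsub (Finset.card_le_two.trans h2)] at hx
    simpa using (Finset.mem_filter.1 hx).1

/-- A CS-GNN whose output is the number of pairs consisting of an edge and an ordered pair of
adjacent common neighbours of its ends, up to a constant factor. -/
def cliqueCounter (d : ℕ) : CSGNN d 1 where
  r := 1
  s := 1
  layers :=
    .cons
      { k₁ := 1, k₂ := 0, k₃ := 0, k₄ := 0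
        agg₁ := .sumMap (fun x _ => x (Fin.last d)) (by fun_prop)
        agg₂ := .sumMap (fun _ => 0) continuous_const
        agg₃ := .sumMap (fun _ => 0) continuous_const
        agg₄ := .sumMap (fun _ => 0) continuous_const
        f := fun x _ => x.2.1 0 * (x.2.1 0 - 1)
        continuous_f := by fun_prop } <|
    .cons
      { k₁ := 1, k₂ := 0, k₃ := 0, k₄ := 0
        agg₁ := .sumMap (fun x => x) continuous_id
        agg₂ := .sumMap (fun _ => 0) continuous_const
        agg₃ := .sumMap (fun _ => 0) continuous_const
        agg₄ := .sumMap (fun _ => 0) continuous_const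
        f := fun x _ => x.1 0 * x.2.1 0
        continuous_f := by fun_prop }
    .nil
  mlp₁ := .affine 1 0
  mlp₂ := .affine 1 0

theorem cliqueCounter_eval {d : ℕ} (G : FeatGraph d) :
    (cliqueCounter d).eval singletonsAndEdges G 0 =
      ∑ S ∈ singletonsAndEdges G.n G.graph, ∑ v, neighbourPairsIn G.graph S v *
        ∑ x ∈ G.graph.nbrs v, neighbourPairsIn G.graph S x := by
  have h1 : ∀ S v, ((Multiset.map (fun (x : Vec (d + 1)) (_ : Fin 1) => x (Fin.last d))
      ((G.graph.nbrs v).val.map fun v' => simpleMarking G S v')).sum) 0 =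
        neighboursIn G.graph S v := by
    intro S v
    rw [Multiset.map_map]
    change (∑ x ∈ G.graph.nbrs v, fun _ : Fin 1 => simpleMarking G S x (Fin.last d)) 0 = _
    simp only [simpleMarking, Fin.snoc_last, ind, neighboursIn, Finset.sum_apply]
    rw [Finset.card_filter]
    push_cast
    exact Finset.sum_congr rfl fun x _ => by congr
  have h2 : ∀ (s : Finset (Fin G.n)) (f : Fin G.n → ℝ),
      (Multiset.map (fun x : Vec 1 => x) (s.val.map fun x (_ : Fin 1) => f x)).sum 0 =
        ∑ x ∈ s, f x := by
    intro s f
    rw [Multiset.map_id']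
    change (∑ x ∈ s, fun _ : Fin 1 => f x) 0 = _
    simp [Finset.sum_apply]
  simp only [CSGNN.eval, cliqueCounter, MLP.eval, Matrix.one_mulVec, add_zero, CSStack.run,
    CSLayer.update, Agg.sumMap, h1, h2, neighbourPairsIn]
  exact (Finset.sum_apply (0 : Fin 1) _ _).trans
    (Finset.sum_congr rfl fun S _ => Finset.sum_apply (0 : Fin 1) _ _)

theorem cliqueCounter_eval_eq_zero {d : ℕ} {G : FeatGraph d}
    (h : ∀ a b v w, G.graph.Adj a b → G.graph.Adj v a → G.graph.Adj v b → G.graph.Adj w a →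
      G.graph.Adj w b → ¬ G.graph.Adj v w) :
    (cliqueCounter d).eval singletonsAndEdges G 0 = 0 := by
  rw [cliqueCounter_eval]
  refine Finset.sum_eq_zero fun S hS => Finset.sum_eq_zero fun v _ => ?_
  by_contra hne
  obtain ⟨hv, hsum⟩ := mul_ne_zero_iff.1 hne
  obtain ⟨w, hw, hw0⟩ := Finset.exists_ne_zero_of_sum_ne_zero hsum
  obtain ⟨⟨a, b, hab, rfl⟩, hvS⟩ := adj_of_neighbourPairsIn_ne_zero hS hv
  have hwS := (adj_of_neighbourPairsIn_ne_zero hS hw0).2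
  exact h a b v w hab (hvS a (by simp)) (hvS b (by simp)) (hwS a (by simp)) (hwS b (by simp))
    (Finset.mem_filter.1 hw).2

theorem cliqueCounter_eval_pos {d : ℕ} {G : FeatGraph d} {a b v w : Fin G.n}
    (hab : G.graph.Adj a b) (hva : G.graph.Adj v a) (hvb : G.graph.Adj v b)
    (hwa : G.graph.Adj w a) (hwb : G.graph.Adj w b) (hvw : G.graph.Adj v w) :
    0 < (cliqueCounter d).eval singletonsAndEdges G 0 := by
  rw [cliqueCounter_eval]
  have hnn : ∀ S v, 0 ≤ neighbourPairsIn G.graph S v *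
      ∑ x ∈ G.graph.nbrs v, neighbourPairsIn G.graph S x :=
    fun S v => mul_nonneg (neighbourPairsIn_nonneg _ S v)
      (Finset.sum_nonneg fun x _ => neighbourPairsIn_nonneg _ S x)
  refine Finset.sum_pos' (fun S _ => Finset.sum_nonneg fun v _ => hnn S v)
    ⟨{a, b}, Finset.mem_filter.2 ⟨Finset.mem_univ _, Or.inr ⟨a, b, hab, rfl⟩⟩, ?_⟩
  refine Finset.sum_pos' (fun v _ => hnn _ v) ⟨v, Finset.mem_univ _, ?_⟩
  rw [neighbourPairsIn_pair hab.ne hva hvb]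
  refine mul_pos two_pos (Finset.sum_pos' (fun x _ => neighbourPairsIn_nonneg _ _ x)
    ⟨w, by simpa using hvw, ?_⟩)
  rw [neighbourPairsIn_pair hab.ne hwa hwb]
  exact two_pos

/-! ### The rook's graph and the Shrikhande graph -/

/-- Adjacency in two strongly regular graphs on `16` vertices, which are written as `4 i + j`: the
rook's graph on the `4 × 4` board and the Shrikhande graph. -/
def srgAdj (rook : Bool) (u v : Fin 16) : Bool :=
  if rook then u ≠ v && (u.val / 4 == v.val / 4 || u.val % 4 == v.val % 4)
  else
    [(0, 1), (0, 3), (1, 0), (3, 0), (1, 1), (3, 3)].contains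
      ((u.val / 4 + 4 - v.val / 4) % 4, (u.val % 4 + 4 - v.val % 4) % 4)

/-- The relation between two vertices: equal, adjacent, or neither. -/
def srgColour (rook : Bool) (u v : Fin 16) : Fin 3 :=
  if u = v then 0 else if srgAdj rook u v then 1 else 2

theorem srgAdj_symm : ∀ b u v, srgAdj b u v = srgAdj b v u := by decide +kernel

theorem srgAdj_irrefl : ∀ b u, srgAdj b u u = false := by decide +kernel

theorem srgColour_symm : ∀ b u v, srgColour b u v = srgColour b v u := by decide +kernel

/-- Strong regularity with parameters (16, 6, 2, 2): two nodes have two common neighbours whether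
adjacent or not. In the adjacent row, the `0` is `u` itself. -/
theorem srgColour_nbrs : ∀ b u v,
    (Finset.univ.filter fun x => srgAdj b v x = true).val.map (srgColour b u) =
      (![Multiset.replicate 6 1, 0 ::ₘ (Multiset.replicate 2 1 + Multiset.replicate 3 2),
        Multiset.replicate 2 1 + Multiset.replicate 4 2] : Fin 3 → Multiset (Fin 3))
          (srgColour b u v) := by
  decide +kernel

theorem srgColour_univ : ∀ b u, Finset.univ.val.map (srgColour b u) =
    0 ::ₘ (Multiset.replicate 6 1 + Multiset.replicate 9 2) := by
  decide +kernel

/-- Hypotheses are interleaved with quantifiers so that the exhaustive check prunes early. -/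
theorem shrikhande_cliqueFree : ∀ a b, srgAdj false a b = true → ∀ v, srgAdj false v a = true →
    srgAdj false v b = true → ∀ w, srgAdj false w a = true → srgAdj false w b = true →
      srgAdj false v w = false := by
  decide +kernel

/-- The rook's graph or the Shrikhande graph, with all features zero. -/
abbrev srgGraph (d : ℕ) (rook : Bool) : FeatGraph d where
  n := 16
  graph :=
    { Adj := fun u v => srgAdj rook u v = true
      symm := ⟨fun u v h => by rwa [srgAdj_symm]⟩
      loopless := ⟨fun u h => by simp [srgAdj_irrefl] at h⟩ }
  feat := 0

theorem srgGraph_nbrs (d : ℕ) (b : Bool) (v : Fin 16) :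
    (srgGraph d b).graph.nbrs v = Finset.univ.filter fun x : Fin 16 => srgAdj b v x = true := by
  ext x
  simp only [Finset.mem_filter]

theorem srgColour_eq_zero_iff {b : Bool} {u v : Fin 16} : srgColour b u v = 0 ↔ u = v := by
  unfold srgColour
  split_ifs with h1 h2 <;> simp [h1]

theorem srgColour_self (b : Bool) (u : Fin 16) : srgColour b u u = 0 :=
  srgColour_eq_zero_iff.2 rfl

theorem srgColour_nbrs_eq (d : ℕ) {b b' : Bool} {u v u' v' : Fin 16}
    (h : srgColour b u v = srgColour b' u' v') :
    ((srgGraph d b).graph.nbrs v).val.map (srgColour b u) =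
      ((srgGraph d b').graph.nbrs v').val.map (srgColour b' u') := by
  rw [srgGraph_nbrs, srgGraph_nbrs]
  exact (srgColour_nbrs b u v).trans (h ▸ (srgColour_nbrs b' u' v').symm)

theorem srgColour_locallyEquitable (d : ℕ) :
    LocallyEquitable (srgGraph d) fun b => srgColour b where
  feat _ := rfl
  eq_iff {i j u v u' v'} h := by
    rw [← srgColour_eq_zero_iff (b := i), ← srgColour_eq_zero_iff (b := j), h]
  left _ := (srgColour_self _ _).trans (srgColour_self _ _).symm
  right _ := (srgColour_self _ _).trans (srgColour_self _ _).symm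
  nbrs_right h := srgColour_nbrs_eq d h
  nbrs_left {i j u v u' v'} h := by
    have h' : srgColour i v u = srgColour j v' u' := by
      rw [srgColour_symm i, srgColour_symm j]
      exact h
    exact Multiset.map_eq_map_of_map_eq (srgColour_nbrs_eq d h') fun x _ y _ e => by
      rw [srgColour_symm i, srgColour_symm j]
      exact e

theorem nodeGNN_eval_srgGraph_eq {d o : ℕ} (M : NodeGNN d o) :
    M.eval (srgGraph d true) = M.eval (srgGraph d false) :=
  M.eval_eq_of_equitable (srgColour_locallyEquitable d)
    (fun {i j u u'} _ => (srgColour_univ i u).trans (srgColour_univ j u').symm)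
    (fun i j => by
      refine Multiset.map_congr rfl fun x _ => ?_
      exact (srgColour_self i x).trans (srgColour_self j x).symm) true false

end

theorem mainTheorem7 :
    (∀ (d o : ℕ) (G₁ G₂ : FeatGraph d),
      (∃ M : NodeGNN d o, M.eval G₁ ≠ M.eval G₂) →
        ∃ M' : CSGNN d o, M'.eval singletonsAndEdges G₁ ≠ M'.eval singletonsAndEdges G₂) ∧
    (∀ d : ℕ, ∃ G₁ G₂ : FeatGraph d,
      (∀ (o : ℕ) (M : NodeGNN d o), M.eval G₁ = M.eval G₂) ∧
        ∃ M' : CSGNN d 1, M'.eval singletonsAndEdges G₁ ≠ M'.eval singletonsAndEdges G₂) := by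
  refine ⟨fun d o G₁ G₂ ⟨M, hM⟩ => ?_, fun d => ⟨srgGraph d true, srgGraph d false,
    fun o M => nodeGNN_eval_srgGraph_eq M, cliqueCounter d, fun h => ?_⟩⟩
  · by_contra hne
    push Not at hne
    exact hM (NodeGNN.eval_eq_of_csgnn_eval_eq hne M)
  -- The nodes 0, 1, 2, 3 form a row of the board, hence a `K₄`.
  · have adj : ∀ u v : Fin 16, srgAdj true u v = true → (srgGraph d true).graph.Adj u v :=
      fun _ _ h => h
    have hpos := cliqueCounter_eval_pos (adj 0 1 (by decide)) (adj 2 0 (by decide))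
      (adj 2 1 (by decide)) (adj 3 0 (by decide)) (adj 3 1 (by decide)) (adj 2 3 (by decide))
    rw [h, cliqueCounter_eval_eq_zero fun a b v w hab hva hvb hwa hwb =>
      Bool.eq_false_iff.1 (shrikhande_cliqueFree a b hab v hva hvb w hwa hwb)] at hpos
    exact lt_irrefl _ hpos
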